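/- Let $k$ be a field and let $l\ge 2$ be an integer. Index the rows and columns of $2l\times 2l$ matrices by $1,\dots,l,-1,\dots,-l$ and those of $(2l+1)\times(2l+1)$ matrices by $0,1,\dots,l,-1,\dots,-l$, and write $e_{a,b}$ for the matrix with $1$ in position $(a,b)$ and $0$ elsewhere. Let $\mathrm{Sp}(2l,k)$, $\mathrm{O}(2l,k)$ and $\mathrm{O}(2l+1,k)$ be the groups of matrices $X$ over $k$ with ${}^TX\beta X=\beta$, where $\beta$ is respectively $$\begin{pmatrix}0&I_l\\-I_l&0\end{pmatrix},\qquad \begin{pmatrix}0&I_l\\ I_l&0\end{pmatrix},\qquad \begin{pmatrix}2&0&0\\0&0&I_l\\0&I_l&0\end{pmatrix}.$$ The elementary matrices are the following, where $t\in k$ and $1\le i,j\le l$. For $\mathrm{O}(2l,k)$: $I+t(e_{i,j}-e_{-j,-i})$ for $i\ne j$; $I+t(e_{i,-j}-e_{j,-i})$ and $I+t(e_{-i,j}-e_{-j,i})$ for $i<j$; and $w_l=I-e_{l,l}-e_{-l,-l}-e_{l,-l}-e_{-l,l}$. For $\mathrm{O}(2l+1,k)$: $I+t(e_{i,j}-e_{-j,-i})$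 for $i\ne j$; $I+t(e_{i,-j}-e_{j,-i})$ and $I+t(e_{-i,j}-e_{-j,i})$ for $i<j$; $I+t(2e_{i,0}-e_{0,-i})-t^2e_{i,-i}$; and $I+t(-2e_{-i,0}+e_{0,i})-t^2e_{-i,i}$. For $\mathrm{Sp}(2l,k)$: $I+t(e_{i,j}-e_{-j,-i})$ for $i\ne j$; $I+t(e_{i,-j}+e_{j,-i})$ and $I+t(e_{-i,j}+e_{-j,i})$ for $i<j$; $I+te_{i,-i}$; and $I+te_{-i,i}$. ($\mathcal A$) Suppose that the characteristic of $k$ is not $2$. Every $g\in\mathrm{O}(2l,k)$ can be written as $g=x_1\cdots x_n\,\mathrm{diag}(1,\dots,1,\lambda,1,\dots,1,\lambda^{-1})$ with $n\ge 0$, elementary matrices $x_1,\dots,x_n$ for $\mathrm{O}(2l,k)$, and $\lambda\in k^\times$. Every $g\in\mathrm{O}(2l+1,k)$ can be written as $g=x_1\cdots x_n\,\mathrm{diag}(\vartheta,1,\dots,1,\lambda,1,\dots,1,\lambda^{-1})$ with $n\ge 0$, elementary matrices $x_1,\dots,x_n$ for $\mathrm{O}(2l+1,k)$, $\lambda\in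 k^\times$ and $\vartheta=\pm1$. Here $\lambda$ and $\lambda^{-1}$ stand in the positions $(l,l)$ and $(-l,-l)$. ($\mathcal B$) For $k$ of any characteristic, every element of $\mathrm{Sp}(2l,k)$ is a product of elementary matrices for $\mathrm{Sp}(2l,k)$. -/

import Mathlib

open Matrix

/-- Indices `1, …, l, -1, …, -l`: `Sum.inl i` stands for `i`, and `Sum.inr i` for `-i`
(with `Fin l` in the role of `{1, …, l}`). -/
abbrev EvenIndex (l : ℕ) : Type := Fin l ⊕ Fin l

/-- Indices `0, 1, …, l, -1, …, -l`. -/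
abbrev OddIndex (l : ℕ) : Type := Unit ⊕ EvenIndex l

namespace EvenIndex

/-- The index `i`. -/
abbrev pos {l : ℕ} (i : Fin l) : EvenIndex l := Sum.inl i

/-- The index `-i`. -/
abbrev neg {l : ℕ} (i : Fin l) : EvenIndex l := Sum.inr i

end EvenIndex

namespace OddIndex

/-- The index `0`. -/
abbrev zero {l : ℕ} : OddIndex l := Sum.inl ()

/-- The index `i`. -/
abbrev pos {l : ℕ} (i : Fin l) : OddIndex l := Sum.inr (EvenIndex.pos i)

/-- The index `-i`. -/
abbrev neg {l : ℕ} (i : Fin l) : OddIndex l := Sum.inr (EvenIndex.neg i)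

end OddIndex

/-- The split symmetric form `(0 I; I 0)` in dimension `2l`. -/
def splitFormEven (l : ℕ) (k : Type*) [Field k] : Matrix (EvenIndex l) (EvenIndex l) k :=
  fromBlocks 0 1 1 0

/-- The split symmetric form `(2 0 0; 0 0 I; 0 I 0)` in dimension `2l + 1`. -/
def splitFormOdd (l : ℕ) (k : Type*) [Field k] : Matrix (OddIndex l) (OddIndex l) k :=
  fromBlocks (diagonal fun _ => 2) 0 0 (splitFormEven l k)

/-- The alternating form `(0 I; -I 0)` in dimension `2l`. -/
def alternatingForm (l : ℕ) (k : Type*) [Field k] : Matrix (EvenIndex l) (EvenIndex l) k :=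
  fromBlocks 0 1 (-1) 0

/-- The matrices `X` with `Xᵀ β X = β`. For an invertible `β` (as are the three forms above, the
odd-dimensional one outside characteristic 2) all of them are invertible, and they form
a group. -/
def matrixIsometries {n k : Type*} [Fintype n] [DecidableEq n] [Field k] (β : Matrix n n k) :
    Submonoid (Matrix n n k) where
  carrier := {X | Xᵀ * β * X = β}
  one_mem' := by simp
  mul_mem' := by
    intro X Y hX hY
    have hX' : Xᵀ * β * X = β := hX
    have hY' : Yᵀ * β * Y = β := hY
    calc (X * Y)ᵀ * β * (X * Y) = Yᵀ * (Xᵀ * β * X) * Y := by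
          simp only [transpose_mul, Matrix.mul_assoc]
      _ = β := by rw [hX', hY']

/-- The split orthogonal group `O(2l, k)`. -/
def splitOrthogonalEven (l : ℕ) (k : Type*) [Field k] :
    Submonoid (Matrix (EvenIndex l) (EvenIndex l) k) :=
  matrixIsometries (splitFormEven l k)

/-- The split orthogonal group `O(2l + 1, k)`. -/
def splitOrthogonalOdd (l : ℕ) (k : Type*) [Field k] :
    Submonoid (Matrix (OddIndex l) (OddIndex l) k) :=
  matrixIsometries (splitFormOdd l k)

/-- The symplectic group `Sp(2l, k)`. -/
def symplecticMatrices (l : ℕ) (k : Type*) [Field k] :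
    Submonoid (Matrix (EvenIndex l) (EvenIndex l) k) :=
  matrixIsometries (alternatingForm l k)

/-- It is Mathlib's symplectic group. -/
theorem symplecticMatrices_eq (l : ℕ) (k : Type*) [Field k] :
    symplecticMatrices l k = Matrix.symplecticGroup (Fin l) k := by
  have h : alternatingForm l k = -Matrix.J (Fin l) k := by
    simp [alternatingForm, Matrix.J, Matrix.fromBlocks_neg]
  ext X
  rw [SymplecticGroup.mem_iff']
  change Xᵀ * alternatingForm l k * X = alternatingForm l k ↔ _
  rw [h]
  simp

section Elementary

open EvenIndex in
/-- The elementary matrices of `O(2l, k)`, including `w_l`. -/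
inductive IsElementaryEven {l : ℕ} {k : Type*} [Field k] :
    Matrix (EvenIndex l) (EvenIndex l) k → Prop
  /-- `x_{i,j}(t)`, `i ≠ j`. -/
  | xPosPos (i j : Fin l) (t : k) (h : i ≠ j) : IsElementaryEven
      (1 + t • (single (pos i) (pos j) 1 - single (neg j) (neg i) 1))
  /-- `x_{i,-j}(t)`, `i < j`. -/
  | xPosNeg (i j : Fin l) (t : k) (h : i < j) : IsElementaryEven
      (1 + t • (single (pos i) (neg j) 1 - single (pos j) (neg i) 1))
  /-- `x_{-i,j}(t)`, `i < j`. -/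
  | xNegPos (i j : Fin l) (t : k) (h : i < j) : IsElementaryEven
      (1 + t • (single (neg i) (pos j) 1 - single (neg j) (pos i) 1))
  /-- `w_l`; here `p` is the index `l`, the last element of `Fin l`. -/
  | w (p : Fin l) (h : (p : ℕ) + 1 = l) : IsElementaryEven
      (1 - single (pos p) (pos p) 1 - single (neg p) (neg p) 1
        - single (pos p) (neg p) 1 - single (neg p) (pos p) 1)

open OddIndex in
/-- The elementary matrices of `O(2l + 1, k)`. -/
inductive IsElementaryOdd {l : ℕ} {k : Type*} [Field k] :
    Matrix (OddIndex l) (OddIndex l) k → Prop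
  /-- `x_{i,j}(t)`, `i ≠ j`. -/
  | xPosPos (i j : Fin l) (t : k) (h : i ≠ j) : IsElementaryOdd
      (1 + t • (single (pos i) (pos j) 1 - single (neg j) (neg i) 1))
  /-- `x_{i,-j}(t)`, `i < j`. -/
  | xPosNeg (i j : Fin l) (t : k) (h : i < j) : IsElementaryOdd
      (1 + t • (single (pos i) (neg j) 1 - single (pos j) (neg i) 1))
  /-- `x_{-i,j}(t)`, `i < j`. -/
  | xNegPos (i j : Fin l) (t : k) (h : i < j) : IsElementaryOdd
      (1 + t • (single (neg i) (pos j) 1 - single (neg j) (pos i) 1))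
  /-- `x_{i,0}(t)`. -/
  | xPosZero (i : Fin l) (t : k) : IsElementaryOdd
      (1 + t • (single (pos i) zero 2 - single zero (neg i) 1)
        - t ^ 2 • single (pos i) (neg i) 1)
  /-- `x_{0,i}(t)`. -/
  | xZeroPos (i : Fin l) (t : k) : IsElementaryOdd
      (1 + t • (single zero (pos i) 1 - single (neg i) zero 2)
        - t ^ 2 • single (neg i) (pos i) 1)

open EvenIndex in
/-- The elementary matrices of `Sp(2l, k)`. -/
inductive IsElementarySymplectic {l : ℕ} {k : Type*} [Field k] :
    Matrix (EvenIndex l) (EvenIndex l) k → Prop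
  /-- `x_{i,j}(t)`, `i ≠ j`. -/
  | xPosPos (i j : Fin l) (t : k) (h : i ≠ j) : IsElementarySymplectic
      (1 + t • (single (pos i) (pos j) 1 - single (neg j) (neg i) 1))
  /-- `x_{i,-j}(t)`, `i < j`. -/
  | xPosNeg (i j : Fin l) (t : k) (h : i < j) : IsElementarySymplectic
      (1 + t • (single (pos i) (neg j) 1 + single (pos j) (neg i) 1))
  /-- `x_{-i,j}(t)`, `i < j`. -/
  | xNegPos (i j : Fin l) (t : k) (h : i < j) : IsElementarySymplectic
      (1 + t • (single (neg i) (pos j) 1 + single (neg j) (pos i) 1))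
  /-- `x_{i,-i}(t)`. -/
  | xPosNegSelf (i : Fin l) (t : k) : IsElementarySymplectic
      (1 + t • single (pos i) (neg i) 1)
  /-- `x_{-i,i}(t)`. -/
  | xNegPosSelf (i : Fin l) (t : k) : IsElementarySymplectic
      (1 + t • single (neg i) (pos i) 1)

end Elementary

/-- The diagonal of `diag(1, …, 1, lam, 1, …, 1, lam⁻¹)`: the entry `lam` is at the index `l`
and the entry `lam⁻¹` at the index `-l`. -/
def diagEntries (l : ℕ) {k : Type*} [Field k] (lam : kˣ) : EvenIndex l → k :=
  Sum.elim (fun i => if (i : ℕ) + 1 = l then (lam : k) else 1)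
    (fun i => if (i : ℕ) + 1 = l then (lam : k)⁻¹ else 1)

/-- `diag(1, …, 1, lam, 1, …, 1, lam⁻¹)` of size `2l`. -/
def diagEven (l : ℕ) {k : Type*} [Field k] (lam : kˣ) : Matrix (EvenIndex l) (EvenIndex l) k :=
  diagonal (diagEntries l lam)

/-- `diag(th, 1, …, 1, lam, 1, …, 1, lam⁻¹)` of size `2l + 1`. -/
def diagOdd (l : ℕ) {k : Type*} [Field k] (th : k) (lam : kˣ) :
    Matrix (OddIndex l) (OddIndex l) k :=
  diagonal (Sum.elim (fun _ => th) (diagEntries l lam))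

/-!
In a Witt basis, a root element (Siegel transformation) attached to `e_{-a}` changes one coordinate
`v_b` of an isotropic vector `v` with `v_a = 1` by an arbitrary amount, at the cost of changing
`v_{-a}`. Hence the elementary matrices move `v` to `e_a`: clear all `v_b` with `b ≠ a, -a`; then
isotropy forces `v_{-a} = 0`, except in the symplectic case, where a transvection clears it. Applied
to `g e_a` and then to the image of `e_{-a}`, this fixes the hyperbolic planes one after the other,
each time using only elements that fix the planes already treated.

What remains is to achieve `v_a = 1`. A second hyperbolic plane makes this possible, and so do the
transvections in the symplectic case. Thus for `Sp` nothing is left over, while for the orthogonal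
groups the last plane can only be fixed up to a diagonal matrix, once a `g` exchanging its two
isotropic lines has been corrected by `w_l` or by a short root element; in odd dimension, `g` may
further act by `±1` on the anisotropic line.
-/

section Matrices

variable {n k : Type*} [Fintype n] [DecidableEq n] [Field k]

theorem mem_matrixIsometries_iff {β g : Matrix n n k} :
    g ∈ matrixIsometries β ↔
      ∀ v w, toBilin' β (g *ᵥ v) (g *ᵥ w) = toBilin' β v w := by
  have key (v w : n → k) : toBilin' β (g *ᵥ v) (g *ᵥ w) = toBilin' (gᵀ * β * g) v w := by
    rw [toBilin'_apply', toBilin'_apply', Matrix.mul_assoc, ← mulVec_mulVec, ← mulVec_mulVec,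
      dotProduct_mulVec v, vecMul_transpose]
  simp only [key]
  exact ⟨fun h v w => congrArg (fun M => toBilin' M v w) h,
    fun h => toBilin'.injective (LinearMap.ext₂ h)⟩

/-- The matrices fixing the basis vectors `e_c` with `c ∈ F`. -/
def basisFixer (k : Type*) [Field k] (F : Set n) : Submonoid (Matrix n n k) where
  carrier := {x | ∀ c ∈ F, x *ᵥ Pi.single c 1 = Pi.single c 1}
  one_mem' _ _ := one_mulVec _
  mul_mem' hx hy c hc := by rw [← mulVec_mulVec, hy c hc, hx c hc]

theorem basisFixer_antitone : Antitone (basisFixer k : Set n → Submonoid (Matrix n n k)) :=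
  fun _ _ hFG _ hx c hc => hx c (hFG hc)

theorem insert_mem_basisFixer {F : Set n} {a : n} {x : Matrix n n k}
    (ha : x *ᵥ Pi.single a 1 = Pi.single a 1) (hx : x ∈ basisFixer k F) :
    x ∈ basisFixer k (insert a F) :=
  Set.forall_mem_insert.2 ⟨ha, hx⟩

theorem eq_one_of_mem_basisFixer_univ {x : Matrix n n k} (hx : x ∈ basisFixer k Set.univ) :
    x = 1 :=
  ext_of_mulVec_single fun c => by rw [hx c trivial, one_mulVec]

theorem single_one_mulVec (a b : n) (v : n → k) :
    single a b (1 : k) *ᵥ v = v b • Pi.single a 1 := by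
  ext c
  simp [single_mulVec, Function.update_apply, Pi.single_apply]

theorem transvection_mulVec (a b : n) (r : k) (v : n → k) :
    transvection a b r *ᵥ v = v + (r * v b) • Pi.single a 1 := by
  have : single a b r = r • single a b 1 := by simp
  rw [transvection, add_mulVec, one_mulVec, this, smul_mulVec, single_one_mulVec, smul_smul]

end Matrices

theorem exists_mul_eq_one_of_mem_closure {M : Type*} [Monoid M] {s : Set M}
    (hs : ∀ x ∈ s, ∃ y ∈ s, y * x = 1) {x : M} (hx : x ∈ Submonoid.closure s) :
    ∃ y ∈ Submonoid.closure s, y * x = 1 := by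
  induction hx using Submonoid.closure_induction with
  | mem x hx =>
    obtain ⟨y, hy, hyx⟩ := hs x hx
    exact ⟨y, Submonoid.subset_closure hy, hyx⟩
  | one => exact ⟨1, one_mem _, one_mul 1⟩
  | mul x x' _ _ ihx ihx' =>
    obtain ⟨y, hy, hyx⟩ := ihx
    obtain ⟨y', hy', hyx'⟩ := ihx'
    exact ⟨y' * y, mul_mem hy' hy, by rw [mul_assoc, ← mul_assoc y, hyx, one_mul, hyx']⟩

/-- An `ε`-symmetric bilinear form on `n → k`, with `ε = sign`, given in a Witt basis: the basis
vector `e_c` pairs only with `e_{conj c}`, with the value `weight c`. The indices with `conj c ≠ c`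
span hyperbolic planes, those with `conj c = c` an anisotropic complement. -/
structure WittForm (n k : Type*) [Fintype n] [Field k] where
  conj : n → n
  weight : n → k
  sign : k
  conj_conj : ∀ c, conj (conj c) = c
  weight_ne_zero : ∀ c, weight c ≠ 0
  weight_conj : ∀ c, weight (conj c) = sign * weight c
  two_ne_zero : ∀ c, conj c = c → (2 : k) ≠ 0
  anisotropic : ∀ v : n → k, (∀ c, conj c ≠ c → v c = 0) → ∑ c, weight c * v c ^ 2 = 0 → v = 0

namespace WittForm

variable {n k : Type*} [Fintype n] [Field k] (P : WittForm n k)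
  {F : Set n} {a b c p : n} {t r : k} {v w : n → k} {g x : Matrix n n k}

attribute [simp] conj_conj

theorem conj_injective : Function.Injective P.conj :=
  Function.Involutive.injective P.conj_conj

theorem conj_ne (h : b ≠ P.conj a) : P.conj b ≠ a :=
  fun hb => h (by rw [← hb, P.conj_conj])

theorem conj_notMem (hF : Set.MapsTo P.conj F F) (h : a ∉ F) : P.conj a ∉ F :=
  fun ha => h (P.conj_conj a ▸ hF ha)

theorem mapsTo_conj_insert (hF : Set.MapsTo P.conj F F) (a : n) :
    Set.MapsTo P.conj (insert a (insert (P.conj a) F)) (insert a (insert (P.conj a) F)) := by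
  rintro c (rfl | rfl | hc)
  · simp
  · simp
  · simp [hF hc]

/-- The indices of the basis vectors spanning the hyperbolic planes. -/
def hyperbolic : Set n :=
  {c | P.conj c ≠ c}

theorem mapsTo_conj_hyperbolic : Set.MapsTo P.conj P.hyperbolic P.hyperbolic :=
  fun _ hc => P.conj_injective.ne hc

theorem mapsTo_conj_hyperbolic_diff (p : n) :
    Set.MapsTo P.conj (P.hyperbolic \ {p, P.conj p}) (P.hyperbolic \ {p, P.conj p}) := by
  intro c hc
  have hcp : P.conj c = p ↔ c = P.conj p := Function.Involutive.eq_iff P.conj_conj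
  simp_all [hyperbolic, P.conj_injective.eq_iff, eq_comm]

theorem sign_eq_one (h : P.conj c = c) : P.sign = 1 :=
  mul_right_cancel₀ (P.weight_ne_zero c) (by rw [← P.weight_conj, h, one_mul])

variable [DecidableEq n]

/-- The Gram matrix of the form. -/
def toMatrix : Matrix n n k :=
  of fun a b => if b = P.conj a then P.weight a else 0

/-- The bilinear form itself. -/
def form : LinearMap.BilinForm k (n → k) :=
  toBilin' P.toMatrix

/-- The isometry group of the form. -/
def isometries : Submonoid (Matrix n n k) :=
  matrixIsometries P.toMatrix

theorem form_apply (v w : n → k) : P.form v w = ∑ c, v c * (P.weight c * w (P.conj c)) := by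
  simp [form, toBilin'_apply', dotProduct, mulVec, toMatrix]

theorem form_single_left (b : n) (w : n → k) :
    P.form (Pi.single b 1) w = P.weight b * w (P.conj b) := by
  simp [form_apply, Pi.single_apply]

theorem form_single_right (v : n → k) (b : n) :
    P.form v (Pi.single b 1) = P.weight (P.conj b) * v (P.conj b) := by
  have (c : n) : P.conj c = b ↔ c = P.conj b :=
    Function.Involutive.eq_iff P.conj_conj
  simp [form_apply, Pi.single_apply, this, mul_comm]

theorem mem_isometries_iff : g ∈ P.isometries ↔
    ∀ v w, P.form (g *ᵥ v) (g *ᵥ w) = P.form v w :=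
  mem_matrixIsometries_iff

variable {P}

theorem apply_conj_of_mulVec_single (hg : g ∈ P.isometries)
    (h : g *ᵥ Pi.single c 1 = Pi.single c 1) (v : n → k) :
    (g *ᵥ v) (P.conj c) = v (P.conj c) := by
  have := P.mem_isometries_iff.1 hg (Pi.single c 1) v
  rw [h, form_single_left, form_single_left] at this
  exact mul_left_cancel₀ (P.weight_ne_zero c) this

theorem apply_of_mem_basisFixer (hF : Set.MapsTo P.conj F F) (hg : g ∈ P.isometries)
    (hgF : g ∈ basisFixer k F) (v : n → k) (hc : c ∈ F) : (g *ᵥ v) c = v c := by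
  simpa using apply_conj_of_mulVec_single hg (hgF _ (hF hc)) v

theorem apply_eq_zero_of_mem_basisFixer (hF : Set.MapsTo P.conj F F)
    (hg : g ∈ P.isometries ⊓ basisFixer k F) (ha : a ∉ F) :
    ∀ c ∈ F, (g *ᵥ Pi.single a 1) c = 0 := fun c hc => by
  rw [apply_of_mem_basisFixer hF hg.1 hg.2 _ hc, Pi.single_eq_of_ne (ne_of_mem_of_not_mem hc ha)]

section Isotropic

variable (P) in
/-- A vector is isotropic if it pairs to zero with itself. -/
def IsIsotropic (v : n → k) : Prop :=
  P.form v v = 0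

theorem isIsotropic_single (ha : P.conj a ≠ a) : P.IsIsotropic (Pi.single a 1) := by
  rw [IsIsotropic, form_single_left, Pi.single_eq_of_ne ha, mul_zero]

theorem IsIsotropic.mulVec (hv : P.IsIsotropic v) (hg : g ∈ P.isometries) :
    P.IsIsotropic (g *ᵥ v) :=
  (P.mem_isometries_iff.1 hg v v).trans hv

/-- Cancelling pairs of hyperbolic coordinates leaves the anisotropic part of the vector. -/
theorem IsIsotropic.apply_eq_zero (hv : P.IsIsotropic v)
    (h : ∀ b, P.conj b ≠ b → v b * v (P.conj b) = 0) (hc : P.conj c = c) : v c = 0 := by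
  classical
  let u : n → k := fun b => if P.conj b = b then v b else 0
  have hu : u = 0 := by
    refine P.anisotropic u (fun b hb => if_neg hb) ?_
    rw [← hv, form_apply]
    refine Finset.sum_congr rfl fun b _ => ?_
    by_cases hb : P.conj b = b
    · simp only [u, if_pos hb, hb]; ring
    · simp only [u, if_neg hb]; linear_combination -P.weight b * h b hb
  simpa [u, hc] using congrFun hu c

theorem IsIsotropic.exists_apply_ne_zero (hv : P.IsIsotropic v) (h0 : v ≠ 0) :
    ∃ b, P.conj b ≠ b ∧ v b ≠ 0 := by
  by_contra! h
  refine h0 (funext fun c => ?_)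
  by_cases hc : P.conj c = c
  · exact hv.apply_eq_zero (fun b hb => by rw [h b hb, zero_mul]) hc
  · exact h c hc

theorem mulVec_single_ne_zero (hg : g ∈ P.isometries) (a : n) : g *ᵥ Pi.single a 1 ≠ 0 := by
  intro h
  have := P.mem_isometries_iff.1 hg (Pi.single a 1) (Pi.single (P.conj a) 1)
  rw [h, map_zero, LinearMap.zero_apply, form_single_left, Pi.single_eq_same, mul_one] at this
  exact P.weight_ne_zero a this.symm

end Isotropic

section Siegel

variable (P) in
/-- The Siegel (Eichler) transformation attached to `e_{conj a}` and `t e_b`: the matrix of a long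
root if `conj b ≠ b` and `r = 0`, and of a short root if `conj b = b`. -/
def siegel (a b : n) (t r : k) : Matrix n n k :=
  1 + t • single b a 1 - (t * P.weight b / P.weight a) • single (P.conj a) (P.conj b) 1
    - r • single (P.conj a) a 1

theorem siegel_mulVec (a b : n) (t r : k) (v : n → k) :
    P.siegel a b t r *ᵥ v = v + (t * v a) • Pi.single b 1
      - (t * P.weight b / P.weight a * v (P.conj b) + r * v a) • Pi.single (P.conj a) 1 := by
  simp only [siegel, sub_mulVec, add_mulVec, one_mulVec, smul_mulVec, single_one_mulVec, smul_smul,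
    add_smul, sub_sub]

theorem siegel_mem_isometries (ha : P.conj a ≠ a) (hba : b ≠ a)
    (hr : r * (P.weight a + P.weight (P.conj a)) = if P.conj b = b then t ^ 2 * P.weight b else 0) :
    P.siegel a b t r ∈ P.isometries := by
  rw [mem_isometries_iff]
  intro v w
  have h := P.weight_ne_zero a
  have hab : P.conj b ≠ P.conj a := P.conj_injective.ne hba
  simp only [siegel_mulVec, map_add, map_sub, map_smul, LinearMap.add_apply, LinearMap.sub_apply,
    LinearMap.smul_apply, form_single_left, form_single_right, smul_eq_mul, conj_conj,
    Pi.single_apply, P.weight_conj, hab, ha.symm, hba.symm, if_false] at hr ⊢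
  by_cases hb : P.conj b = b
  · simp only [hb, if_true, P.sign_eq_one hb] at hr ⊢
    field_simp
    linear_combination (-v a * w a * P.weight a) * hr
  · simp only [if_neg hb] at hr ⊢
    field_simp
    linear_combination (-v a * w a * P.weight a) * hr

theorem transvection_mem_isometries (hr : r * (P.weight a + P.weight (P.conj a)) = 0)
    (ha : P.conj a ≠ a) : transvection (P.conj a) a r ∈ P.isometries := by
  rw [mem_isometries_iff]
  intro v w
  simp only [transvection_mulVec, map_add, map_smul, LinearMap.add_apply, LinearMap.smul_apply,
    form_single_left, form_single_right, smul_eq_mul, conj_conj, Pi.single_eq_of_ne ha.symm]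
  linear_combination v a * w a * hr

theorem siegel_conj_conj (a b : n) (t : k) :
    P.siegel (P.conj b) (P.conj a) (-(t * P.weight b / P.weight a)) 0 = P.siegel a b t 0 := by
  have ha := P.weight_ne_zero a
  have hb := P.weight_ne_zero b
  have : -(t * P.weight b / P.weight a) * P.weight (P.conj a) / P.weight (P.conj b) = -t := by
    have hs : P.sign ≠ 0 :=
      left_ne_zero_of_mul (P.weight_conj a ▸ P.weight_ne_zero (P.conj a))
    rw [P.weight_conj, P.weight_conj]
    field_simp
  simp only [siegel, conj_conj, this, zero_smul, neg_smul]
  abel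

theorem siegel_neg_mul_siegel (ha : P.conj a ≠ a) (hba : b ≠ a)
    (hr : r * (P.weight a + P.weight (P.conj a)) = if P.conj b = b then t ^ 2 * P.weight b else 0) :
    P.siegel a b (-t) (P.sign * r) * P.siegel a b t r = 1 := by
  refine ext_of_mulVec_single fun c => ?_
  generalize (Pi.single c 1 : n → k) = v
  have h := P.weight_ne_zero a
  have hab : P.conj b ≠ P.conj a := P.conj_injective.ne hba
  rw [← mulVec_mulVec, one_mulVec, siegel_mulVec, siegel_mulVec]
  ext c
  simp only [Pi.add_apply, Pi.sub_apply, Pi.smul_apply, smul_eq_mul, Pi.single_apply, hab,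
    hba.symm, ha.symm, if_false, P.weight_conj] at hr ⊢
  by_cases hb : P.conj b = b
  · simp only [hb, if_true, P.sign_eq_one hb] at hr ⊢
    field_simp
    linear_combination (-v a * P.weight a * if c = P.conj a then 1 else 0) * hr
  · simp only [if_neg hb] at hr ⊢
    field_simp
    linear_combination (-v a * P.weight a * if c = P.conj a then 1 else 0) * hr

theorem siegel_mem_basisFixer (ha : a ∉ F) (hb : P.conj b ∉ F) (t r : k) :
    P.siegel a b t r ∈ basisFixer k F := by
  intro c hc
  rw [siegel_mulVec, Pi.single_eq_of_ne (ne_of_mem_of_not_mem hc ha).symm,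
    Pi.single_eq_of_ne (ne_of_mem_of_not_mem hc hb).symm]
  simp

theorem transvection_mem_basisFixer (ha : a ∉ F) (b : n) (r : k) :
    transvection b a r ∈ basisFixer k F := by
  intro c hc
  rw [transvection_mulVec, Pi.single_eq_of_ne (ne_of_mem_of_not_mem hc ha).symm]
  simp

end Siegel

section Elementary

variable (P) in
/-- The elementary isometries: the root elements of the long roots, of the short roots (which
exist if some `conj c = c`), and the transvections along a basis vector (which are trivial for a
symmetric form in characteristic different from 2). -/
inductive IsElementary : Matrix n n k → Prop
  | long (a b : n) (t : k) (ha : P.conj a ≠ a) (hb : P.conj b ≠ b) (hba : b ≠ a)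
      (hba' : b ≠ P.conj a) : IsElementary (P.siegel a b t 0)
  | short (a b : n) (t r : k) (ha : P.conj a ≠ a) (hb : P.conj b = b)
      (hr : r * (P.weight a + P.weight (P.conj a)) = t ^ 2 * P.weight b) :
      IsElementary (P.siegel a b t r)
  | transvection (a : n) (r : k) (ha : P.conj a ≠ a)
      (hr : r * (P.weight a + P.weight (P.conj a)) = 0) :
      IsElementary (transvection (P.conj a) a r)

variable (P) in
/-- The subgroup generated by the elementary isometries; as these are closed under inversion, it is
the submonoid they generate. -/
def elementary : Submonoid (Matrix n n k) :=
  Submonoid.closure {x | P.IsElementary x}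

theorem IsElementary.mem_elementary (hx : P.IsElementary x) : x ∈ P.elementary :=
  Submonoid.subset_closure hx

theorem elementary_le_isometries : P.elementary ≤ P.isometries := by
  refine Submonoid.closure_le.2 fun x hx => ?_
  cases hx with
  | long a b t ha hb hba => exact siegel_mem_isometries ha hba (by simp [hb])
  | short a b t r ha hb hr =>
    exact siegel_mem_isometries ha (fun h => ha (h ▸ hb)) (by simpa [hb] using hr)
  | transvection a r ha hr => exact transvection_mem_isometries hr ha

theorem IsElementary.exists_mul_eq_one (hx : P.IsElementary x) :
    ∃ y, P.IsElementary y ∧ y * x = 1 := by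
  cases hx with
  | long a b t ha hb hba hba' =>
    refine ⟨_, .long a b (-t) ha hb hba hba', ?_⟩
    simpa using siegel_neg_mul_siegel (t := t) (r := 0) ha hba (by simp [hb])
  | short a b t r ha hb hr =>
    refine ⟨_, .short a b (-t) r ha hb (by simpa using hr), ?_⟩
    simpa [P.sign_eq_one hb] using
      siegel_neg_mul_siegel (t := t) ha (fun h => ha (h ▸ hb)) (by simpa [hb] using hr)
  | transvection a r ha hr =>
    refine ⟨_, .transvection a (-r) ha (by rw [neg_mul, hr, neg_zero]), ?_⟩
    rw [transvection_mul_transvection_same _ _ ha, neg_add_cancel, transvection_zero]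

theorem exists_mul_eq_one_of_mem_elementary (hx : x ∈ P.elementary) :
    ∃ y ∈ P.elementary, y * x = 1 :=
  exists_mul_eq_one_of_mem_closure (fun _ => IsElementary.exists_mul_eq_one) hx

theorem exists_eq_mul_of_mul_mem {H : Submonoid (Matrix n n k)} (hg : g ∈ P.isometries)
    (h : ∃ x ∈ P.elementary, x * g ∈ H) :
    ∃ x ∈ P.elementary, ∃ g' ∈ P.isometries ⊓ H, g = x * g' := by
  obtain ⟨x, hx, hxg⟩ := h
  obtain ⟨y, hy, hyx⟩ := exists_mul_eq_one_of_mem_elementary hx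
  refine ⟨y, hy, x * g, ⟨mul_mem (elementary_le_isometries hx) hg, hxg⟩, ?_⟩
  rw [← mul_assoc, hyx, one_mul]

theorem exists_isElementary_siegel (ha : P.conj a ≠ a) (hba : b ≠ a) (hba' : b ≠ P.conj a)
    (t : k) : ∃ r, P.IsElementary (P.siegel a b t r) := by
  by_cases hb : P.conj b = b
  · refine ⟨t ^ 2 * P.weight b / (2 * P.weight a), .short a b t _ ha hb ?_⟩
    have h2 := P.two_ne_zero b hb
    have hwa := P.weight_ne_zero a
    rw [P.weight_conj, P.sign_eq_one hb]
    field_simp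
    ring
  · exact ⟨0, .long a b t ha hb hba hba'⟩

end Elementary

section Clearing

theorem exists_clear_off_pair (hF : Set.MapsTo P.conj F F) (ha : P.conj a ≠ a) (haF : a ∉ F)
    (hva : v a = 1) (hvF : ∀ c ∈ F, v c = 0) :
    ∃ x ∈ P.elementary ⊓ basisFixer k (insert (P.conj a) F),
      (x *ᵥ v) a = 1 ∧ ∀ b, b ≠ a → b ≠ P.conj a → (x *ᵥ v) b = 0 := by
  suffices key : ∀ T : Finset n, ∃ x ∈ P.elementary ⊓ basisFixer k (insert (P.conj a) F),
      (x *ᵥ v) a = 1 ∧ ∀ b ∈ T, b ≠ a → b ≠ P.conj a → (x *ᵥ v) b = 0 by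
    simpa using key Finset.univ
  intro T
  induction T using Finset.induction_on with
  | empty => exact ⟨1, one_mem _, by rwa [one_mulVec], by simp⟩
  | insert b T _ ih =>
    obtain ⟨x, ⟨hx, hxF⟩, hxa, hxT⟩ := ih
    have hxvF : ∀ c ∈ F, (x *ᵥ v) c = 0 := fun c hc =>
      (apply_of_mem_basisFixer hF (elementary_le_isometries hx)
        (basisFixer_antitone (Set.subset_insert _ _) hxF) v hc).trans (hvF c hc)
    by_cases hb : b = a ∨ b = P.conj a ∨ b ∈ F
    · exact ⟨x, ⟨hx, hxF⟩, hxa, by grind⟩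
    obtain ⟨hba, hba', hbF⟩ : b ≠ a ∧ b ≠ P.conj a ∧ b ∉ F := by simpa using hb
    obtain ⟨r, hy⟩ := exists_isElementary_siegel ha hba hba' (-(x *ᵥ v) b)
    have hyF : P.siegel a b (-(x *ᵥ v) b) r ∈ basisFixer k (insert (P.conj a) F) :=
      siegel_mem_basisFixer (by simp [ha.symm, haF])
        (by simp [P.conj_injective.eq_iff, hba, P.conj_notMem hF hbF]) _ _
    refine ⟨_, mul_mem ⟨hy.mem_elementary, hyF⟩ ⟨hx, hxF⟩, ?_, fun c hc hca hca' => ?_⟩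
    · simp [← mulVec_mulVec, siegel_mulVec, hxa, hba.symm, ha.symm]
    · rw [← mulVec_mulVec, siegel_mulVec]
      by_cases hcb : c = b
      · simp [hcb, hxa, hba']
      · simpa [hcb, hca'] using hxT c (Finset.mem_of_mem_insert_of_ne hc hcb) hca hca'

theorem exists_mulVec_eq_single (hF : Set.MapsTo P.conj F F) (ha : P.conj a ≠ a) (haF : a ∉ F)
    (hva : v a = 1) (hvF : ∀ c ∈ F, v c = 0) (hv : P.IsIsotropic v) :
    ∃ x ∈ P.elementary ⊓ basisFixer k (insert (P.conj a) F), x *ᵥ v = Pi.single a 1 := by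
  obtain ⟨x, ⟨hx, hxF⟩, hxa, hx0⟩ := exists_clear_off_pair hF ha haF hva hvF
  have hw : x *ᵥ v = Pi.single a 1 + (x *ᵥ v) (P.conj a) • Pi.single (P.conj a) 1 := by
    ext c
    by_cases hca : c = a
    · simp [hca, hxa, ha.symm]
    by_cases hca' : c = P.conj a
    · simp [hca', ha]
    · simp [hca, hca', hx0 c hca hca']
  have hr : (x *ᵥ v) (P.conj a) * (P.weight a + P.weight (P.conj a)) = 0 := by
    have := hv.mulVec (elementary_le_isometries hx)
    rw [IsIsotropic, hw] at this
    simp only [map_add, map_smul, LinearMap.add_apply, LinearMap.smul_apply, form_single_left,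
      conj_conj, smul_eq_mul, Pi.single_eq_same, Pi.single_eq_of_ne ha,
      Pi.single_eq_of_ne ha.symm] at this
    linear_combination this
  have hy : P.IsElementary (transvection (P.conj a) a (-(x *ᵥ v) (P.conj a))) :=
    .transvection a _ ha (by rw [neg_mul, hr, neg_zero])
  refine ⟨_, mul_mem ⟨hy.mem_elementary, transvection_mem_basisFixer ?_ _ _⟩ ⟨hx, hxF⟩, ?_⟩
  · simp [ha.symm, haF]
  · rw [← mulVec_mulVec, transvection_mulVec, hxa, mul_one, neg_smul, ← sub_eq_add_neg]
    nth_rw 1 [hw]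
    rw [add_sub_cancel_right]

end Clearing

section Normalizing

variable (P) in
/-- The elements of `P.elementary` fixing `e_c` for `c ∈ F` move every nonzero isotropic vector
supported off `F` to one with `a`-coordinate `1`. -/
def IsNormalizable (F : Set n) (a : n) : Prop :=
  ∀ v ≠ 0, P.IsIsotropic v → (∀ c ∈ F, v c = 0) →
    ∃ x ∈ P.elementary ⊓ basisFixer k F, (x *ᵥ v) a = 1

theorem exists_apply_eq_one (hF : Set.MapsTo P.conj F F) (ha : P.conj a ≠ a) (haF : a ∉ F)
    (hb : P.conj b ≠ b) (hbF : b ∉ F) (hab : a ≠ b) (hab' : a ≠ P.conj b) (hvb : v b ≠ 0) :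
    ∃ x ∈ P.elementary ⊓ basisFixer k F, (x *ᵥ v) a = 1 := by
  refine ⟨_, ⟨(IsElementary.long b a ((1 - v a) / v b) hb ha hab hab').mem_elementary,
    siegel_mem_basisFixer hbF (P.conj_notMem hF haF) _ _⟩, ?_⟩
  simp [siegel_mulVec, hab', hvb]

theorem isNormalizable_of_spare (hF : Set.MapsTo P.conj F F) (ha : P.conj a ≠ a) (haF : a ∉ F)
    (hp : P.conj p ≠ p) (hpF : p ∉ F) (hpa : p ≠ a) (hpa' : p ≠ P.conj a) :
    P.IsNormalizable F a := by
  intro v h0 hv hvF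
  obtain ⟨b, hb, hvb⟩ := hv.exists_apply_ne_zero h0
  have hbF : b ∉ F := fun h => hvb (hvF b h)
  by_cases hab : a ≠ b ∧ a ≠ P.conj b
  · exact exists_apply_eq_one hF ha haF hb hbF hab.1 hab.2 hvb
  have hpb : p ≠ b ∧ p ≠ P.conj b := by grind [P.conj_conj]
  obtain ⟨x, hx, hxp⟩ := exists_apply_eq_one hF hp hpF hb hbF hpb.1 hpb.2 hvb
  obtain ⟨y, hy, hya⟩ := exists_apply_eq_one (v := x *ᵥ v) hF ha haF hp hpF hpa.symm
    (P.conj_ne hpa').symm (by simp [hxp])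
  exact ⟨y * x, mul_mem hy hx, by rw [← mulVec_mulVec, hya]⟩

theorem isNormalizable_of_weight_add_eq_zero (hF : Set.MapsTo P.conj F F) (ha : P.conj a ≠ a)
    (haF : a ∉ F) (hw : P.weight a + P.weight (P.conj a) = 0) : P.IsNormalizable F a := by
  intro v h0 hv hvF
  have of_conj_ne (u : n → k) (hu : u (P.conj a) ≠ 0) :
      ∃ x ∈ P.elementary ⊓ basisFixer k F, (x *ᵥ u) a = 1 := by
    have hx : P.IsElementary (transvection (P.conj (P.conj a)) (P.conj a)
        ((1 - u a) / u (P.conj a))) :=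
      .transvection _ _ (by simpa using ha.symm) (by rw [P.conj_conj, add_comm, hw, mul_zero])
    refine ⟨_, ⟨hx.mem_elementary, transvection_mem_basisFixer (P.conj_notMem hF haF) _ _⟩, ?_⟩
    simp [transvection_mulVec, hu]
  by_cases hva' : v (P.conj a) ≠ 0
  · exact of_conj_ne v hva'
  by_cases hva : v a ≠ 0
  · have hx : P.IsElementary (transvection (P.conj a) a 1) :=
      .transvection _ _ ha (by rw [hw, mul_zero])
    obtain ⟨y, hy, hya⟩ := of_conj_ne (transvection (P.conj a) a 1 *ᵥ v) (by
      simpa [transvection_mulVec, not_not.1 hva'] using hva)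
    exact ⟨_, mul_mem hy ⟨hx.mem_elementary, transvection_mem_basisFixer haF _ _⟩,
      by rw [← mulVec_mulVec, hya]⟩
  · obtain ⟨b, hb, hvb⟩ := hv.exists_apply_ne_zero h0
    exact exists_apply_eq_one hF ha haF hb (fun h => hvb (hvF b h)) (fun h => hva (h ▸ hvb))
      (fun h => hva' (by rwa [h, P.conj_conj])) hvb

end Normalizing

section Reduction

theorem exists_mul_mem_basisFixer_insert (hF : Set.MapsTo P.conj F F) (ha : P.conj a ≠ a)
    (haF : a ∉ F) (hg : g ∈ P.isometries ⊓ basisFixer k F) (hga : (g *ᵥ Pi.single a 1) a = 1) :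
    ∃ x ∈ P.elementary, x * g ∈ basisFixer k (insert a (insert (P.conj a) F)) := by
  have haF' := P.conj_notMem hF haF
  have ha' : P.conj (P.conj a) ≠ P.conj a := by simpa using ha.symm
  obtain ⟨x, ⟨hx, hxF⟩, hxa⟩ := exists_mulVec_eq_single hF ha haF hga
    (apply_eq_zero_of_mem_basisFixer hF hg haF) ((isIsotropic_single ha).mulVec hg.1)
  have hxg : x * g ∈ P.isometries := mul_mem (elementary_le_isometries hx) hg.1
  have hxgF : x * g ∈ basisFixer k F :=
    mul_mem (basisFixer_antitone (Set.subset_insert _ _) hxF) hg.2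
  rw [mulVec_mulVec] at hxa
  have hxga : ((x * g) *ᵥ Pi.single (P.conj a) 1) (P.conj a) = 1 := by
    rw [apply_conj_of_mulVec_single hxg hxa, Pi.single_eq_same]
  obtain ⟨y, ⟨hy, hyF⟩, hya⟩ := exists_mulVec_eq_single hF ha' haF' hxga
    (apply_eq_zero_of_mem_basisFixer hF ⟨hxg, hxgF⟩ haF') ((isIsotropic_single ha').mulVec hxg)
  rw [P.conj_conj] at hyF
  refine ⟨y * x, mul_mem hy hx, ?_⟩
  rw [mul_assoc]
  refine insert_mem_basisFixer ?_ (insert_mem_basisFixer ?_ ?_)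
  · rw [← mulVec_mulVec, hxa, hyF a (Set.mem_insert _ _)]
  · rw [← mulVec_mulVec, hya]
  · exact mul_mem (basisFixer_antitone (Set.subset_insert _ _) hyF) hxgF

theorem IsNormalizable.exists_mul_mem_basisFixer_insert (h : P.IsNormalizable F a)
    (hF : Set.MapsTo P.conj F F) (ha : P.conj a ≠ a) (haF : a ∉ F)
    (hg : g ∈ P.isometries ⊓ basisFixer k F) :
    ∃ x ∈ P.elementary, x * g ∈ basisFixer k (insert a (insert (P.conj a) F)) := by
  obtain ⟨y, ⟨hy, hyF⟩, hya⟩ := h (g *ᵥ Pi.single a 1) (mulVec_single_ne_zero hg.1 a)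
    ((isIsotropic_single ha).mulVec hg.1) (apply_eq_zero_of_mem_basisFixer hF hg haF)
  rw [mulVec_mulVec] at hya
  obtain ⟨x, hx, hxF⟩ := WittForm.exists_mul_mem_basisFixer_insert hF ha haF
    (mul_mem ⟨elementary_le_isometries hy, hyF⟩ hg) hya
  exact ⟨x * y, mul_mem hx hy, by rwa [mul_assoc]⟩

theorem exists_mul_mem_basisFixer {S : Set n} (hS : Set.MapsTo P.conj S S)
    (hconj : ∀ a ∈ S, P.conj a ≠ a)
    (hnorm : ∀ F ⊆ S, Set.MapsTo P.conj F F → ∀ a ∈ S \ F, P.IsNormalizable F a)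
    (hg : g ∈ P.isometries) : ∃ x ∈ P.elementary, x * g ∈ basisFixer k S := by
  suffices key : ∃ F ⊆ S, S ⊆ F ∧ Set.MapsTo P.conj F F ∧
      ∃ x ∈ P.elementary, x * g ∈ basisFixer k F by
    obtain ⟨F, -, hSF, -, x, hx, hxg⟩ := key
    exact ⟨x, hx, basisFixer_antitone hSF hxg⟩
  refine Set.Finite.induction_on_subset (motive := fun T _ => ∃ F ⊆ S, T ⊆ F ∧
    Set.MapsTo P.conj F F ∧ ∃ x ∈ P.elementary, x * g ∈ basisFixer k F) S S.toFinite ?_ ?_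
  · exact ⟨∅, by simp, subset_rfl, by simp, 1, one_mem _, by simp [basisFixer]⟩
  rintro a T haS - - ⟨F, hFS, hTF, hF, x, hx, hxg⟩
  by_cases haF : a ∈ F
  · exact ⟨F, hFS, Set.insert_subset haF hTF, hF, x, hx, hxg⟩
  obtain ⟨y, hy, hyF⟩ := (hnorm F hFS hF a ⟨haS, haF⟩).exists_mul_mem_basisFixer_insert hF
    (hconj a haS) haF ⟨mul_mem (elementary_le_isometries hx) hg, hxg⟩
  refine ⟨insert a (insert (P.conj a) F), ?_, ?_, P.mapsTo_conj_insert hF a, y * x, mul_mem hy hx,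
    by rwa [mul_assoc]⟩
  · exact Set.insert_subset haS (Set.insert_subset (hS haS) hFS)
  · exact Set.insert_subset_insert (hTF.trans (Set.subset_insert _ _))

end Reduction

section Torus

variable (P) in
/-- The isometry scaling `e_p` by `s` and `e_{conj p}` by `s⁻¹`. -/
def torus (p : n) (s : kˣ) : Matrix n n k :=
  diagonal fun c => if c = p then (s : k) else if c = P.conj p then (s : k)⁻¹ else 1

theorem torus_mulVec_single (p c : n) (s : kˣ) :
    P.torus p s *ᵥ Pi.single c 1 =
      (if c = p then (s : k) else if c = P.conj p then (s : k)⁻¹ else 1) • Pi.single c 1 := by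
  rw [torus, diagonal_mulVec_single, mul_one, ← Pi.single_smul', smul_eq_mul, mul_one]

theorem torus_inv_mul_torus (p : n) (s : kˣ) : P.torus p s⁻¹ * P.torus p s = 1 := by
  rw [torus, torus, diagonal_mul_diagonal, ← diagonal_one]
  congr 1
  ext c
  split_ifs <;> simp

theorem torus_mem_isometries (hp : P.conj p ≠ p) (s : kˣ) : P.torus p s ∈ P.isometries := by
  rw [mem_isometries_iff]
  intro v w
  simp only [form_apply, torus, mulVec_diagonal]
  refine Finset.sum_congr rfl fun c _ => ?_
  have hcp : P.conj c = P.conj p ↔ c = p := P.conj_injective.eq_iff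
  have hcp' : P.conj c = p ↔ c = P.conj p := Function.Involutive.eq_iff P.conj_conj
  simp only [hcp, hcp']
  split_ifs with h1 h2 <;> first | exact absurd (h2.symm.trans h1) hp | field_simp

theorem exists_eq_mul_torus (hp : P.conj p ≠ p)
    (hg : g ∈ P.isometries ⊓ basisFixer k (P.hyperbolic \ {p, P.conj p}))
    (hgp : (g *ᵥ Pi.single p 1) p ≠ 0) :
    ∃ x ∈ P.elementary, ∃ h ∈ P.isometries ⊓ basisFixer k P.hyperbolic, ∃ s : kˣ,
      g = x * h * P.torus p s := by
  let s : kˣ := Units.mk0 _ hgp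
  have hgs : g * P.torus p s⁻¹ ∈
      P.isometries ⊓ basisFixer k (P.hyperbolic \ {p, P.conj p}) := by
    refine mul_mem hg ⟨torus_mem_isometries hp _, fun c hc => ?_⟩
    rw [torus_mulVec_single, if_neg fun h => hc.2 (.inl h),
      if_neg fun h : c = P.conj p => hc.2 (.inr h), one_smul]
  have hgsp : ((g * P.torus p s⁻¹) *ᵥ Pi.single p 1) p = 1 := by
    rw [← mulVec_mulVec, torus_mulVec_single, if_pos rfl, mulVec_smul, Pi.smul_apply]
    exact s.inv_mul
  obtain ⟨x, hx, h, hh, hxh⟩ := exists_eq_mul_of_mul_mem hgs.1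
    (exists_mul_mem_basisFixer_insert (P.mapsTo_conj_hyperbolic_diff p) hp (by simp) hgs hgsp)
  have hsub : P.hyperbolic ⊆ insert p (insert (P.conj p) (P.hyperbolic \ {p, P.conj p})) := by
    intro c hc
    simp only [Set.mem_insert_iff, Set.mem_sdiff, Set.mem_singleton_iff]
    tauto
  refine ⟨x, hx, h, ⟨hh.1, basisFixer_antitone hsub hh.2⟩, s, ?_⟩
  rw [← hxh, mul_assoc, torus_inv_mul_torus, mul_one]

theorem apply_conj_ne_zero (hp : P.conj p ≠ p)
    (hg : g ∈ P.isometries ⊓ basisFixer k (P.hyperbolic \ {p, P.conj p}))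
    (hgp : (g *ᵥ Pi.single p 1) p = 0) : (g *ᵥ Pi.single p 1) (P.conj p) ≠ 0 := by
  obtain ⟨b, hb, hvb⟩ := ((isIsotropic_single hp).mulVec hg.1).exists_apply_ne_zero
    (mulVec_single_ne_zero hg.1 p)
  have hbp : b = p ∨ b = P.conj p := by
    by_contra h
    exact hvb (apply_eq_zero_of_mem_basisFixer (P.mapsTo_conj_hyperbolic_diff p) hg (by simp) b
      ⟨hb, h⟩)
  rcases hbp with rfl | rfl
  · exact absurd hgp hvb
  · exact hvb

/-- The pair `p, conj p` serves as the spare pair for all the others. When `g e_p` has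
`p`-coordinate zero after the reduction, `E` has to supply an element that repairs this. -/
theorem exists_eq_mul_mul_torus {E : Submonoid (Matrix n n k)} (hE : P.elementary ≤ E)
    (hp : P.conj p ≠ p)
    (hswap : ∀ g ∈ P.isometries ⊓ basisFixer k (P.hyperbolic \ {p, P.conj p}),
      (g *ᵥ Pi.single p 1) p = 0 →
        ∃ x ∈ P.isometries ⊓ basisFixer k (P.hyperbolic \ {p, P.conj p}), ∃ y ∈ E, y * x = 1 ∧
          ((x * g) *ᵥ Pi.single p 1) p ≠ 0)
    (hg : g ∈ P.isometries) :
    ∃ x ∈ E, ∃ h ∈ P.isometries ⊓ basisFixer k P.hyperbolic, ∃ s : kˣ,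
      g = x * h * P.torus p s := by
  obtain ⟨x, hx, g', hg', rfl⟩ := exists_eq_mul_of_mul_mem hg <|
    exists_mul_mem_basisFixer (P.mapsTo_conj_hyperbolic_diff p) (fun _ ha => ha.1)
      (fun F hFS hF a ha => isNormalizable_of_spare hF ha.1.1 ha.2 hp
        (fun h => (hFS h).2 (.inl rfl)) (fun h => ha.1.2 (.inl h.symm))
        (fun h => ha.1.2 (.inr (h ▸ (P.conj_conj a).symm)))) hg
  by_cases hgp : (g' *ᵥ Pi.single p 1) p = 0
  · obtain ⟨w, hw, y, hy, hyw, hwp⟩ := hswap g' hg' hgp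
    obtain ⟨z, hz, h, hh, s, hs⟩ := exists_eq_mul_torus hp (mul_mem hw hg') hwp
    refine ⟨x * (y * z), mul_mem (hE hx) (mul_mem hy (hE hz)), h, hh, s, ?_⟩
    calc x * g' = x * (y * (w * g')) := by rw [← mul_assoc y, hyw, one_mul]
      _ = x * (y * z) * h * P.torus p s := by simp only [hs, mul_assoc]
  · obtain ⟨z, hz, h, hh, s, rfl⟩ := exists_eq_mul_torus hp hg' hgp
    exact ⟨x * z, mul_mem (hE hx) (hE hz), h, hh, s, by simp only [mul_assoc]⟩

end Torus

theorem isometries_le_elementary (hconj : ∀ a, P.conj a ≠ a)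
    (hw : ∀ a, P.weight a + P.weight (P.conj a) = 0) : P.isometries ≤ P.elementary := by
  intro g hg
  obtain ⟨x, hx, h, hh, rfl⟩ := exists_eq_mul_of_mul_mem hg <|
    exists_mul_mem_basisFixer (S := Set.univ) (fun _ _ => trivial) (fun a _ => hconj a)
      (fun F _ hF a ha => isNormalizable_of_weight_add_eq_zero hF (hconj a) ha.2 (hw a)) hg
  rwa [eq_one_of_mem_basisFixer_univ hh.2, mul_one]

end WittForm

section LongRoots

variable {k n : Type*} [Field k] [Fintype n] [DecidableEq n] {l : ℕ}

open EvenIndex in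
theorem WittForm.siegel_mem_of_forall {P : WittForm n k} {E : Submonoid (Matrix n n k)}
    {ι : EvenIndex l → n} (hι : ∀ a, P.conj (ι a) = ι a.swap)
    (pos_pos : ∀ i j, i ≠ j → ∀ t, P.siegel (ι (pos j)) (ι (pos i)) t 0 ∈ E)
    (pos_neg : ∀ i j, i < j → ∀ t, P.siegel (ι (neg j)) (ι (pos i)) t 0 ∈ E)
    (neg_pos : ∀ i j, i < j → ∀ t, P.siegel (ι (pos j)) (ι (neg i)) t 0 ∈ E)
    {a b : EvenIndex l} (hba : b ≠ a) (hba' : b ≠ a.swap) (t : k) :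
    P.siegel (ι a) (ι b) t 0 ∈ E := by
  -- `siegel_conj_conj` brings the two indices of a root element into the required order.
  rcases a with j | j <;> rcases b with i | i
  · exact pos_pos i j (by simpa using hba) t
  · have hij : i ≠ j := by simpa using hba'
    rcases hij.lt_or_gt with h | h
    · exact neg_pos i j h t
    · rw [← siegel_conj_conj, hι, hι]
      exact neg_pos j i h _
  · have hij : i ≠ j := by simpa using hba'
    rcases hij.lt_or_gt with h | h
    · exact pos_neg i j h t
    · rw [← siegel_conj_conj, hι, hι]
      exact pos_neg j i h _
  · rw [← siegel_conj_conj, hι, hι]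
    exact pos_pos j i (by simpa using hba.symm) _

end LongRoots

section Hyperbolic

variable {k : Type*} [Field k] {l : ℕ} {ε : k}

/-- The form `(0 I; εI 0)`, where `ε = ±1`. -/
def hyperbolicWittForm (l : ℕ) (ε : k) (hε : ε * ε = 1) : WittForm (EvenIndex l) k where
  conj := Sum.swap
  weight := Sum.elim 1 fun _ => ε
  sign := ε
  conj_conj := Sum.swap_swap
  weight_ne_zero := by rintro (_ | _) <;> simp [left_ne_zero_of_mul_eq_one hε]
  weight_conj := by rintro (c | c) <;> simp [hε]
  two_ne_zero := by simp
  anisotropic v hv _ := funext fun c => hv c (by cases c <;> simp)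

theorem hyperbolicWittForm_toMatrix (hε : ε * ε = 1) :
    (hyperbolicWittForm l ε hε).toMatrix = fromBlocks 0 1 (ε • 1) 0 := by
  ext (a | a) (b | b) <;>
    simp [hyperbolicWittForm, WittForm.toMatrix, one_apply, eq_comm]

theorem hyperbolicWittForm_conj_ne (hε : ε * ε = 1) (c : EvenIndex l) :
    (hyperbolicWittForm l ε hε).conj c ≠ c := by
  cases c <;> simp [hyperbolicWittForm]

end Hyperbolic

section Symplectic

variable {k : Type*} [Field k] {l : ℕ}

/-- The alternating form `(0 I; -I 0)` as an `ε`-symmetric form. -/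
def symplecticWittForm (l : ℕ) (k : Type*) [Field k] : WittForm (EvenIndex l) k :=
  hyperbolicWittForm l (-1) (by ring)

theorem symplecticWittForm_isometries :
    (symplecticWittForm l k).isometries = symplecticMatrices l k := by
  simp [WittForm.isometries, symplecticMatrices, alternatingForm, symplecticWittForm,
    hyperbolicWittForm_toMatrix]

theorem siegel_symplecticWittForm_mem {a b : EvenIndex l} (hba : b ≠ a) (hba' : b ≠ a.swap)
    (t : k) : (symplecticWittForm l k).siegel a b t 0 ∈
      Submonoid.closure {x | IsElementarySymplectic x} := by
  refine WittForm.siegel_mem_of_forall (ι := id) (fun _ => rfl) (fun i j h t => ?_)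
    (fun i j h t => ?_) (fun i j h t => ?_) hba hba' t <;> refine Submonoid.subset_closure ?_
  · simpa [WittForm.siegel, symplecticWittForm, hyperbolicWittForm, smul_sub, add_sub_assoc]
      using IsElementarySymplectic.xPosPos i j t h
  · simpa [WittForm.siegel, symplecticWittForm, hyperbolicWittForm, div_neg, add_assoc]
      using IsElementarySymplectic.xPosNeg i j t h
  · simpa [WittForm.siegel, symplecticWittForm, hyperbolicWittForm, div_neg, add_assoc]
      using IsElementarySymplectic.xNegPos i j t h

theorem elementary_symplecticWittForm_le :
    (symplecticWittForm l k).elementary ≤ Submonoid.closure {x | IsElementarySymplectic x} := by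
  refine Submonoid.closure_le.2 fun x hx => ?_
  cases hx with
  | long a b t _ _ hba hba' => exact siegel_symplecticWittForm_mem hba hba' t
  | short a b t r _ hb => exact absurd hb (hyperbolicWittForm_conj_ne _ b)
  | transvection a r =>
    refine Submonoid.subset_closure ?_
    rcases a with i | i
    · simpa [transvection, symplecticWittForm, hyperbolicWittForm]
        using IsElementarySymplectic.xNegPosSelf i r
    · simpa [transvection, symplecticWittForm, hyperbolicWittForm]
        using IsElementarySymplectic.xPosNegSelf i r

theorem symplecticMatrices_le_closure :
    symplecticMatrices l k ≤ Submonoid.closure {x | IsElementarySymplectic x} := by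
  rw [← symplecticWittForm_isometries]
  refine (WittForm.isometries_le_elementary (hyperbolicWittForm_conj_ne _) ?_).trans
    elementary_symplecticWittForm_le
  rintro (c | c) <;> simp [hyperbolicWittForm]

end Symplectic

section OrthogonalEven

variable {k : Type*} [Field k] {l : ℕ}

/-- The symmetric form `(0 I; I 0)` as an `ε`-symmetric form. -/
def evenWittForm (l : ℕ) (k : Type*) [Field k] : WittForm (EvenIndex l) k :=
  hyperbolicWittForm l 1 (one_mul 1)

theorem evenWittForm_isometries :
    (evenWittForm l k).isometries = splitOrthogonalEven l k := by
  simp [WittForm.isometries, splitOrthogonalEven, splitFormEven, evenWittForm,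
    hyperbolicWittForm_toMatrix]

theorem siegel_evenWittForm_mem {a b : EvenIndex l} (hba : b ≠ a) (hba' : b ≠ a.swap)
    (t : k) : (evenWittForm l k).siegel a b t 0 ∈ Submonoid.closure {x | IsElementaryEven x} := by
  refine WittForm.siegel_mem_of_forall (ι := id) (fun _ => rfl) (fun i j h t => ?_)
    (fun i j h t => ?_) (fun i j h t => ?_) hba hba' t <;> refine Submonoid.subset_closure ?_
  · simpa [WittForm.siegel, evenWittForm, hyperbolicWittForm, smul_sub, add_sub_assoc]
      using IsElementaryEven.xPosPos i j t h
  · simpa [WittForm.siegel, evenWittForm, hyperbolicWittForm, smul_sub, add_sub_assoc]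
      using IsElementaryEven.xPosNeg i j t h
  · simpa [WittForm.siegel, evenWittForm, hyperbolicWittForm, smul_sub, add_sub_assoc]
      using IsElementaryEven.xNegPos i j t h

theorem elementary_evenWittForm_le (h2 : (2 : k) ≠ 0) :
    (evenWittForm l k).elementary ≤ Submonoid.closure {x | IsElementaryEven x} := by
  refine Submonoid.closure_le.2 fun x hx => ?_
  cases hx with
  | long a b t _ _ hba hba' => exact siegel_evenWittForm_mem hba hba' t
  | short a b t r _ hb => exact absurd hb (hyperbolicWittForm_conj_ne _ b)
  | transvection a r _ hr =>
    have hr0 : r = 0 := by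
      cases a <;> simpa [evenWittForm, hyperbolicWittForm, one_add_one_eq_two, h2] using hr
    rw [hr0, transvection_zero]
    exact one_mem _

/-- The matrix `w_l`, with `p` in place of `l`. -/
def negSwap (k : Type*) [Field k] (p : Fin l) : Matrix (EvenIndex l) (EvenIndex l) k :=
  1 - single (Sum.inl p) (Sum.inl p) 1 - single (Sum.inr p) (Sum.inr p) 1
    - single (Sum.inl p) (Sum.inr p) 1 - single (Sum.inr p) (Sum.inl p) 1

theorem negSwap_mulVec (p : Fin l) (v : EvenIndex l → k) :
    negSwap k p *ᵥ v = v -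
      (v (Sum.inl p) + v (Sum.inr p)) • (Pi.single (Sum.inl p) 1 + Pi.single (Sum.inr p) 1) := by
  simp only [negSwap, sub_mulVec, one_mulVec, single_one_mulVec]
  module

theorem negSwap_mul_self (p : Fin l) : negSwap k p * negSwap k p = 1 := by
  refine ext_of_mulVec_single fun c => ?_
  rw [← mulVec_mulVec, one_mulVec, negSwap_mulVec, negSwap_mulVec]
  simp only [smul_add, Pi.sub_apply, Pi.add_apply, Pi.smul_apply, Pi.single_eq_same, smul_eq_mul,
    mul_one, ne_eq, reduceCtorEq, not_false_eq_true, Pi.single_eq_of_ne, mul_zero, add_zero,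
    sub_add_cancel_left, zero_add, sub_add_cancel_right]
  module

theorem negSwap_mem_isometries (p : Fin l) : negSwap k p ∈ (evenWittForm l k).isometries := by
  rw [WittForm.mem_isometries_iff]
  intro v w
  simp only [negSwap_mulVec, map_sub, map_add, map_smul, LinearMap.sub_apply, LinearMap.add_apply,
    LinearMap.smul_apply, WittForm.form_single_left, WittForm.form_single_right, smul_eq_mul]
  simp only [evenWittForm, hyperbolicWittForm, Sum.elim_inl, Pi.one_apply, Sum.swap_inl, one_mul,
    Sum.elim_inr, Sum.swap_inr, ne_eq, reduceCtorEq, not_false_eq_true, Pi.single_eq_of_ne,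
    mul_zero, Pi.single_eq_same, mul_one, zero_add, sub_add_cancel_right, add_zero,
    sub_add_cancel_left]
  ring

theorem negSwap_mem_basisFixer (p : Fin l) :
    negSwap k p ∈ basisFixer k {Sum.inl p, Sum.inr p}ᶜ := by
  intro c hc
  simp only [Set.mem_compl_iff, Set.mem_insert_iff, Set.mem_singleton_iff, not_or] at hc
  rw [negSwap_mulVec, Pi.single_eq_of_ne (Ne.symm hc.1), Pi.single_eq_of_ne (Ne.symm hc.2)]
  simp

theorem torus_evenWittForm (s : kˣ) :
    (evenWittForm (l + 1) k).torus (Sum.inl (Fin.last l)) s = diagEven (l + 1) s := by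
  rw [WittForm.torus, diagEven]
  congr 1
  ext (c | c) <;>
    simp [evenWittForm, hyperbolicWittForm, diagEntries, Fin.ext_iff]

theorem exists_eq_mul_diagEven (h2 : (2 : k) ≠ 0) {g : Matrix (EvenIndex l) (EvenIndex l) k}
    (hg : g ∈ splitOrthogonalEven l k) :
    ∃ x ∈ Submonoid.closure {x | IsElementaryEven x}, ∃ s : kˣ, g = x * diagEven l s := by
  cases l with
  | zero => exact ⟨1, one_mem _, 1, Subsingleton.elim _ _⟩
  | succ l =>
    have hp := hyperbolicWittForm_conj_ne (one_mul (1 : k)) (Sum.inl (Fin.last l))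
    have hw : negSwap k (Fin.last l) ∈ Submonoid.closure {x | IsElementaryEven x} :=
      Submonoid.subset_closure (.w _ rfl)
    rw [← evenWittForm_isometries] at hg
    obtain ⟨x, hx, h, hh, s, rfl⟩ := WittForm.exists_eq_mul_mul_torus
      (elementary_evenWittForm_le h2) hp (fun g hg hgp => by
        refine ⟨negSwap k (Fin.last l), ⟨negSwap_mem_isometries _,
          basisFixer_antitone (fun c hc => hc.2) (negSwap_mem_basisFixer _)⟩, _, hw,
          negSwap_mul_self _, ?_⟩
        have hgp' : (g *ᵥ Pi.single (Sum.inl (Fin.last l)) 1) (Sum.inr (Fin.last l)) ≠ 0 :=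
          WittForm.apply_conj_ne_zero hp hg hgp
        rw [← mulVec_mulVec, negSwap_mulVec]
        generalize g *ᵥ Pi.single _ 1 = v at hgp hgp' ⊢
        simpa [hgp] using hgp') hg
    have h1 : h = 1 := eq_one_of_mem_basisFixer_univ <|
      basisFixer_antitone (fun c _ => hyperbolicWittForm_conj_ne _ c) hh.2
    exact ⟨x, hx, s, by rw [h1, mul_one, torus_evenWittForm]⟩

end OrthogonalEven

section OrthogonalOdd

variable {k : Type*} [Field k] {l : ℕ}

/-- The symmetric form `(2 0 0; 0 0 I; 0 I 0)` as an `ε`-symmetric form, with `e_0` spanning the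
anisotropic part. -/
def oddWittForm (l : ℕ) {k : Type*} [Field k] (h2 : (2 : k) ≠ 0) : WittForm (OddIndex l) k where
  conj := Sum.map id Sum.swap
  weight := Sum.elim 2 1
  sign := 1
  conj_conj c := by simp
  weight_ne_zero := by rintro (_ | _) <;> simp [h2]
  weight_conj := by rintro (c | c) <;> simp
  two_ne_zero _ _ := h2
  anisotropic v hv h := by
    have hinr (c : EvenIndex l) : v (Sum.inr c) = 0 := hv _ (by cases c <;> simp)
    have hinl : v (Sum.inl ()) = 0 := by simpa [hinr, h2] using h
    ext (_ | c)
    · exact hinl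
    · exact hinr c

theorem oddWittForm_isometries (h2 : (2 : k) ≠ 0) :
    (oddWittForm l h2).isometries = splitOrthogonalOdd l k := by
  have : (oddWittForm l h2).toMatrix = splitFormOdd l k := by
    ext (a | a | a) (b | b | b) <;>
      simp [oddWittForm, WittForm.toMatrix, splitFormOdd, splitFormEven, one_apply, eq_comm]
  rw [WittForm.isometries, this, splitOrthogonalOdd]

theorem siegel_oddWittForm_mem (h2 : (2 : k) ≠ 0) {a b : EvenIndex l} (hba : b ≠ a)
    (hba' : b ≠ a.swap) (t : k) : (oddWittForm l h2).siegel (Sum.inr a) (Sum.inr b) t 0 ∈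
      Submonoid.closure {x | IsElementaryOdd x} := by
  refine WittForm.siegel_mem_of_forall (ι := Sum.inr) (fun _ => rfl) (fun i j h t => ?_)
    (fun i j h t => ?_) (fun i j h t => ?_) hba hba' t <;> refine Submonoid.subset_closure ?_
  · simpa [WittForm.siegel, oddWittForm, smul_sub, add_sub_assoc]
      using IsElementaryOdd.xPosPos i j t h
  · simpa [WittForm.siegel, oddWittForm, smul_sub, add_sub_assoc]
      using IsElementaryOdd.xPosNeg i j t h
  · simpa [WittForm.siegel, oddWittForm, smul_sub, add_sub_assoc]
      using IsElementaryOdd.xNegPos i j t h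

theorem siegel_zero_oddWittForm_mem (h2 : (2 : k) ≠ 0) (a : EvenIndex l) (t : k) :
    (oddWittForm l h2).siegel (Sum.inr a) (Sum.inl ()) t (t ^ 2) ∈
      Submonoid.closure {x | IsElementaryOdd x} := by
  refine Submonoid.subset_closure ?_
  rcases a with i | i
  · simpa [WittForm.siegel, oddWittForm, smul_sub, add_sub_assoc]
      using IsElementaryOdd.xZeroPos i t
  · change IsElementaryOdd _
    convert IsElementaryOdd.xPosZero i (-t) using 1
    have h2r : single (OddIndex.pos i) (OddIndex.zero (l := l)) (2 : k) =
        (2 : k) • single (OddIndex.pos i) OddIndex.zero 1 := by simp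
    simp only [WittForm.siegel, h2r, oddWittForm, Sum.map_inl, Sum.map_inr, Sum.elim_inl,
      Sum.elim_inr, Sum.swap_inr, id, Pi.ofNat_apply, div_one]
    module

theorem elementary_oddWittForm_le (h2 : (2 : k) ≠ 0) :
    (oddWittForm l h2).elementary ≤ Submonoid.closure {x | IsElementaryOdd x} := by
  refine Submonoid.closure_le.2 fun x hx => ?_
  cases hx with
  | long a b t ha hb hba hba' =>
    rcases a with a | a
    · exact absurd rfl ha
    rcases b with b | b
    · exact absurd rfl hb
    exact siegel_oddWittForm_mem h2 (fun h => hba (congrArg _ h)) (fun h => hba' (congrArg _ h)) t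
  | short a b t r ha hb hr =>
    rcases a with a | a
    · exact absurd rfl ha
    rcases b with b | b
    · have hrt : r = t ^ 2 := mul_right_cancel₀ h2 <| by
        simpa [oddWittForm, one_add_one_eq_two] using hr
      rw [hrt]
      exact siegel_zero_oddWittForm_mem h2 a t
    · cases b <;> simp [oddWittForm] at hb
  | transvection a r ha hr =>
    have hr0 : r = 0 := by
      rcases a with a | a
      · exact absurd rfl ha
      · simpa [oddWittForm, one_add_one_eq_two, h2] using hr
    rw [hr0, transvection_zero]
    exact one_mem _

theorem torus_oddWittForm (h2 : (2 : k) ≠ 0) (s : kˣ) :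
    (oddWittForm (l + 1) h2).torus (Sum.inr (Sum.inl (Fin.last l))) s = diagOdd (l + 1) 1 s := by
  rw [WittForm.torus, diagOdd]
  congr 1
  ext (c | c | c) <;> simp [oddWittForm, diagEntries, Fin.ext_iff]

theorem diagOdd_mul_diagOdd_one (th : k) (s : kˣ) :
    diagOdd l th 1 * diagOdd l 1 s = diagOdd l th s := by
  rw [diagOdd, diagOdd, diagOdd, diagonal_mul_diagonal]
  congr 1
  ext (c | c | c) <;> simp [diagEntries]

theorem hyperbolic_oddWittForm (h2 : (2 : k) ≠ 0) :
    (oddWittForm l h2).hyperbolic = Set.range Sum.inr := by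
  ext (c | c | c) <;> simp [WittForm.hyperbolic, oddWittForm]

theorem exists_eq_diagOdd_one (h2 : (2 : k) ≠ 0) {h : Matrix (OddIndex l) (OddIndex l) k}
    (hh : h ∈ (oddWittForm l h2).isometries ⊓ basisFixer k (oddWittForm l h2).hyperbolic) :
    ∃ th : k, (th = 1 ∨ th = -1) ∧ h = diagOdd l th 1 := by
  have hzero : h *ᵥ Pi.single OddIndex.zero 1 =
      (h *ᵥ Pi.single OddIndex.zero 1) OddIndex.zero • Pi.single OddIndex.zero 1 := by
    ext (c | c)
    · simp
    · rw [WittForm.apply_eq_zero_of_mem_basisFixer (WittForm.mapsTo_conj_hyperbolic _) hh] <;>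
        simp [hyperbolic_oddWittForm]
  generalize (h *ᵥ Pi.single OddIndex.zero 1) OddIndex.zero = th at hzero
  refine ⟨th, ?_, ext_of_mulVec_single ?_⟩
  · have hform := (WittForm.mem_isometries_iff _).1 hh.1
      (Pi.single OddIndex.zero 1) (Pi.single OddIndex.zero 1)
    rw [hzero] at hform
    simp only [map_smul, LinearMap.smul_apply, WittForm.form_single_left, oddWittForm,
      Sum.map_inl, id, Sum.elim_inl, Pi.ofNat_apply, Pi.single_eq_same, mul_one, smul_eq_mul,
      ← mul_assoc] at hform
    exact mul_self_eq_one_iff.1 (mul_right_cancel₀ h2 (hform.trans (one_mul 2).symm))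
  · rintro (c | c)
    · rw [hzero]
      simp [diagOdd, ← Pi.single_smul']
    · rw [hh.2 _ (by simp [hyperbolic_oddWittForm])]
      rcases c with c | c <;> simp [diagOdd, diagEntries]

theorem exists_mul_apply_ne_zero (h2 : (2 : k) ≠ 0) {p : EvenIndex l}
    {g : Matrix (OddIndex l) (OddIndex l) k}
    (hg : g ∈ (oddWittForm l h2).isometries ⊓ basisFixer k ((oddWittForm l h2).hyperbolic \
      {Sum.inr p, (oddWittForm l h2).conj (Sum.inr p)}))
    (hgp : (g *ᵥ Pi.single (Sum.inr p) 1) (Sum.inr p) = 0) :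
    ∃ x ∈ (oddWittForm l h2).elementary ⊓ basisFixer k ((oddWittForm l h2).hyperbolic \
      {Sum.inr p, (oddWittForm l h2).conj (Sum.inr p)}),
        ((x * g) *ᵥ Pi.single (Sum.inr p) 1) (Sum.inr p) ≠ 0 := by
  have hp : (oddWittForm l h2).conj (Sum.inr p) ≠ Sum.inr p := by
    cases p <;> simp [oddWittForm]
  have hx : (oddWittForm l h2).IsElementary
      ((oddWittForm l h2).siegel ((oddWittForm l h2).conj (Sum.inr p)) (Sum.inl ()) 1 1) :=
    .short _ _ _ _ (by simpa using hp.symm) rfl (by simp [oddWittForm, one_add_one_eq_two])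
  refine ⟨_, ⟨hx.mem_elementary, WittForm.siegel_mem_basisFixer (by simp) (fun h => h.1 rfl) _ _⟩,
    ?_⟩
  have hgp' := WittForm.apply_conj_ne_zero hp hg hgp
  have hg0 : (g *ᵥ Pi.single (Sum.inr p) 1) (Sum.inl ()) = 0 := by
    refine ((WittForm.isIsotropic_single hp).mulVec hg.1).apply_eq_zero (fun b hb => ?_) rfl
    by_cases hbp : b = Sum.inr p ∨ b = (oddWittForm l h2).conj (Sum.inr p)
    · rcases hbp with rfl | rfl <;> simp [hgp]
    · rw [WittForm.apply_eq_zero_of_mem_basisFixer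
        (WittForm.mapsTo_conj_hyperbolic_diff _ _) hg (by simp) b ⟨hb, hbp⟩, zero_mul]
  rw [← mulVec_mulVec, WittForm.siegel_mulVec]
  generalize g *ᵥ Pi.single _ 1 = v at hgp hgp' hg0 ⊢
  have h0 : v ((oddWittForm l h2).conj (Sum.inl ())) = 0 := hg0
  simpa [hgp, h0] using hgp'

theorem exists_eq_mul_diagOdd (h2 : (2 : k) ≠ 0) {g : Matrix (OddIndex l) (OddIndex l) k}
    (hg : g ∈ splitOrthogonalOdd l k) :
    ∃ x ∈ Submonoid.closure {x | IsElementaryOdd x}, ∃ th : k, (th = 1 ∨ th = -1) ∧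
      ∃ s : kˣ, g = x * diagOdd l th s := by
  rw [← oddWittForm_isometries h2] at hg
  cases l with
  | zero =>
    obtain ⟨th, hth, rfl⟩ := exists_eq_diagOdd_one h2 (h := g)
      ⟨hg, by simp [hyperbolic_oddWittForm, basisFixer]⟩
    exact ⟨1, one_mem _, th, hth, 1, (one_mul _).symm⟩
  | succ l =>
    have hp : (oddWittForm (l + 1) h2).conj (OddIndex.pos (Fin.last l)) ≠
        OddIndex.pos (Fin.last l) := by simp [oddWittForm]
    obtain ⟨x, hx, h, hh, s, rfl⟩ := WittForm.exists_eq_mul_mul_torus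
      (elementary_oddWittForm_le h2) hp (fun g hg hgp => by
        obtain ⟨w, ⟨hw, hwF⟩, hwp⟩ := exists_mul_apply_ne_zero h2 hg hgp
        obtain ⟨y, hy, hyw⟩ := WittForm.exists_mul_eq_one_of_mem_elementary hw
        exact ⟨w, ⟨WittForm.elementary_le_isometries hw, hwF⟩, y, elementary_oddWittForm_le h2 hy,
          hyw, hwp⟩) hg
    obtain ⟨th, hth, rfl⟩ := exists_eq_diagOdd_one h2 hh
    exact ⟨x, hx, th, hth, s, by rw [torus_oddWittForm, mul_assoc, diagOdd_mul_diagOdd_one]⟩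

end OrthogonalOdd

theorem theoremA_general {k : Type*} [Field k] (l : ℕ) :
    (ringChar k ≠ 2 →
      (∀ g ∈ splitOrthogonalEven l k,
        ∃ (L : List (Matrix (EvenIndex l) (EvenIndex l) k)) (lam : kˣ),
          (∀ x ∈ L, IsElementaryEven x) ∧ g = L.prod * diagEven l lam) ∧
      (∀ g ∈ splitOrthogonalOdd l k,
        ∃ (L : List (Matrix (OddIndex l) (OddIndex l) k)) (th : k) (lam : kˣ),
          (∀ x ∈ L, IsElementaryOdd x) ∧ (th = 1 ∨ th = -1) ∧
            g = L.prod * diagOdd l th lam)) ∧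
    (∀ g ∈ symplecticMatrices l k,
      ∃ L : List (Matrix (EvenIndex l) (EvenIndex l) k),
        (∀ x ∈ L, IsElementarySymplectic x) ∧ g = L.prod) := by
  refine ⟨fun hk => ⟨fun g hg => ?_, fun g hg => ?_⟩, fun g hg => ?_⟩
  · obtain ⟨x, hx, s, rfl⟩ := exists_eq_mul_diagEven (Ring.two_ne_zero hk) hg
    obtain ⟨L, hL, rfl⟩ := Submonoid.exists_list_of_mem_closure hx
    exact ⟨L, s, hL, rfl⟩
  · obtain ⟨x, hx, th, hth, s, rfl⟩ := exists_eq_mul_diagOdd (Ring.two_ne_zero hk) hg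
    obtain ⟨L, hL, rfl⟩ := Submonoid.exists_list_of_mem_closure hx
    exact ⟨L, th, s, hL, hth, rfl⟩
  · obtain ⟨L, hL, rfl⟩ := Submonoid.exists_list_of_mem_closure (symplecticMatrices_le_closure hg)
    exact ⟨L, hL, rfl⟩

theorem theoremA {k : Type*} [Field k] (l : ℕ) (hl : 2 ≤ l) :
    (ringChar k ≠ 2 →
      (∀ g ∈ splitOrthogonalEven l k,
        ∃ (L : List (Matrix (EvenIndex l) (EvenIndex l) k)) (lam : kˣ),
          (∀ x ∈ L, IsElementaryEven x) ∧ g = L.prod * diagEven l lam) ∧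
      (∀ g ∈ splitOrthogonalOdd l k,
        ∃ (L : List (Matrix (OddIndex l) (OddIndex l) k)) (th : k) (lam : kˣ),
          (∀ x ∈ L, IsElementaryOdd x) ∧ (th = 1 ∨ th = -1) ∧
            g = L.prod * diagOdd l th lam)) ∧
    (∀ g ∈ symplecticMatrices l k,
      ∃ L : List (Matrix (EvenIndex l) (EvenIndex l) k),
        (∀ x ∈ L, IsElementarySymplectic x) ∧ g = L.prod) :=
  theoremA_general l
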